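/- Let $S^2\subset\mathbb{R}^3$ be the unit sphere with poles $N=(0,0,1)$ and $S=(0,0,-1)$, and identify $\mathbb{C}$ with $S^2\setminus\{N\}$ by stereographic projection $(x,y,t)\mapsto (x+iy)/(1-t)$, so that $0$ corresponds to $S$ and $\infty$ to $N$. A Jordan curve $J\subset\mathbb{C}$ separates the poles if $N$ and $S$ lie in different components of $S^2\setminus J$. For such a $J$, a polar path is a continuous path in $S^2$ from $N$ to $S$ that meets $J$ at exactly one point, and the resistance $r(J)\in[0,\infty]$ is the infimum of the lengths (measured in $S^2$) of the polar paths for $J$. **Theorem.** Let $h:S^1\to\mathbb{C}$ send the circle $C^\infty$-diffeomorphically onto a smooth Jordan curve $J$ that separates the poles, that is, $h$ is injective and $C^\infty$ with nowhere vanishing derivative. Then for all real $\delta,L>0$ there is a map $h_1:S^1\to\mathbb{C}$ sending $S^1$ $C^\infty$-diffeomorphically onto a smooth Jordan curve $J_1$ that separates the poles, such that $$\sup_{z\in S^1}|h(z)-h_1(z)|<\delta\qquad\text{and}\qquad r(J_1)>L .$$ -/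

import Mathlib

open scoped ContDiff

noncomputable section

namespace JordanResistance

/-- The unit sphere `S²` of Euclidean `ℝ³`. Its distance is the chordal one; the length of a path
(supremum over inscribed polygons) for the chordal distance is its usual length. -/
abbrev S2 : Type := Metric.sphere (0 : EuclideanSpace ℝ (Fin 3)) 1

def northPole : S2 :=
  ⟨!₂[0, 0, 1], by simp [EuclideanSpace.norm_eq, Fin.sum_univ_three]⟩

def southPole : S2 :=
  ⟨!₂[0, 0, -1], by simp [EuclideanSpace.norm_eq, Fin.sum_univ_three]⟩

lemma stereoInv_mem (z : ℂ) :
    !₂[2 * z.re / (‖z‖ ^ 2 + 1), 2 * z.im / (‖z‖ ^ 2 + 1), (‖z‖ ^ 2 - 1) / (‖z‖ ^ 2 + 1)] ∈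
      Metric.sphere (0 : EuclideanSpace ℝ (Fin 3)) 1 := by
  have h : (‖z‖ ^ 2 + 1 : ℝ) ≠ 0 := by positivity
  have hz : ‖z‖ ^ 2 = z.re ^ 2 + z.im ^ 2 := by
    rw [← Complex.normSq_eq_norm_sq, Complex.normSq_apply]; ring
  rw [mem_sphere_zero_iff_norm, ← sq_eq_sq₀ (norm_nonneg _) zero_le_one, EuclideanSpace.norm_sq_eq]
  simp only [Fin.sum_univ_three, Real.norm_eq_abs, sq_abs, Matrix.cons_val_zero,
    Matrix.cons_val_one, Matrix.cons_val]
  field_simp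
  rw [hz]
  ring

/-- Inverse of the stereographic projection `(x, y, t) ↦ (x + iy) / (1 - t)` from the north pole.
It identifies `ℂ` with the sphere minus the north pole, and `0` with the south pole. -/
def stereoInv (z : ℂ) : S2 :=
  ⟨!₂[2 * z.re / (‖z‖ ^ 2 + 1), 2 * z.im / (‖z‖ ^ 2 + 1), (‖z‖ ^ 2 - 1) / (‖z‖ ^ 2 + 1)],
    stereoInv_mem z⟩

/-- `K` separates `p` from `q`: both lie off `K`, in different components of the complement. -/
def Separates (K : Set S2) (p q : S2) : Prop :=
  p ∉ K ∧ q ∉ K ∧ q ∉ connectedComponentIn Kᶜ p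

/-- A path pierces `K` if it meets `K` at a single point and passes from one component of the
complement of `K` to another. -/
def Pierces {p q : S2} (γ : Path p q) (K : Set S2) : Prop :=
  (∃ x, Set.range γ ∩ K = {x}) ∧ Separates K p q

/-- Length of a path in the sphere (possibly infinite). -/
def pathLength {p q : S2} (γ : Path p q) : ENNReal := eVariationOn γ Set.univ

/-- The resistance of `K`: the infimum of the lengths of the polar paths for `K`, which are the
(continuous) paths from the north pole to the south pole that pierce `K`. -/
def resistance (K : Set S2) : ENNReal :=
  ⨅ (γ : Path northPole southPole) (_ : Pierces γ K), pathLength γ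

/-- `h` sends the circle diffeomorphically (`C^∞`) onto a smooth Jordan curve in `ℂ`: it is
injective, smooth in the angular coordinate, and its derivative vanishes nowhere. -/
structure IsSmoothJordanParam (h : Circle → ℂ) : Prop where
  injective : Function.Injective h
  smooth : ContDiff ℝ ∞ (fun θ : ℝ => h (Circle.exp θ))
  deriv_ne_zero : ∀ θ : ℝ, deriv (fun θ : ℝ => h (Circle.exp θ)) θ ≠ 0

/-- The Jordan curve parametrized by `h`, seen in the Riemann sphere `S²`. -/
def curveOnSphere (h : Circle → ℂ) : Set S2 := stereoInv '' Set.range h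

end JordanResistance

end

/-! Replace `J` by a serpentine curve in a thin collar of `J`. In collar coordinates (circle
coordinate, height `y`) it is a sinusoid with `k` periods and amplitude `w / 2`, sheared by the
rotation of angle `ε * sin (M * y)`. Suppose a path comes from above and first meets this curve at a
point with `y ≤ 0`. Until then it stays above the curve, so once `y ≤ w / 4` it is caught in a
single trough: its unsheared circle coordinate varies by at most `2 * π / k ≤ ε`. The shear swings
by `2 * ε` between consecutive extrema of the sine, so during the descent the path must turn `m`
times by an angle between `ε` and `3 * ε`. Each turn costs at least a length `η` depending only on
the collar and `ε`, whence the bound `m * η` (`le_eVariationOn`). Closeness to `h` only needs `w`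
and `ε` small, so `m` can be chosen afterwards, as large as desired.

Crossings with `y ≥ 0` reduce to this case by the half turn `flip`. The Jordan curve theorem is not
needed: the continuous map `straighten` sends the complement of the serpentine into the complement
of `J`. If a path were short, both of its ends would be joined, off `J`, to the lower half of the
collar (`exists_mem_lower`), contradicting separation. The collar comes from the normal tubular map
of `J` (`exists_collar`). -/

noncomputable section

namespace JordanResistance

/-! ### The serpentine curve in the cylinder `Circle × ℝ` -/

/-- A curve in the cylinder: a sinusoid with `k` periods and amplitude `w / 2`, sheared along the
circle by `ε * sin (M * y)` at height `y`. -/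
def wiggle (w ε M : ℝ) (k : ℕ) (z : Circle) : Circle × ℝ :=
  (z * Circle.exp (ε * Real.sin (M * (w / 2 * ((z : ℂ) ^ k).im))), w / 2 * ((z : ℂ) ^ k).im)

/-- The circle coordinate after undoing the shear. -/
def untwist (ε M : ℝ) (q : Circle × ℝ) : Circle :=
  q.1 * Circle.exp (-(ε * Real.sin (M * q.2)))

/-- A tent function, equal to `1` on `[-w / 2, w / 2]` and to `0` at `-w` and `w`. -/
def cutoff (w y : ℝ) : ℝ := min 1 (2 - 2 * |y| / w)

/-- A height function on the cylinder vanishing exactly on the serpentine curve and equal to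
the second coordinate at `-w` and `w`. -/
def height (w ε M : ℝ) (k : ℕ) (q : Circle × ℝ) : ℝ :=
  q.2 - cutoff w q.2 * (w / 2 * ((untwist ε M q : ℂ) ^ k).im)

section Wiggle

variable {w ε M : ℝ} {k : ℕ}

lemma abs_im_pow_le_one (z : Circle) (k : ℕ) : |((z : ℂ) ^ k).im| ≤ 1 :=
  (Complex.abs_im_le_norm _).trans (by simp [Circle.norm_coe])

lemma continuous_wiggle : Continuous (wiggle w ε M k) := by
  unfold wiggle; fun_prop

lemma continuous_untwist : Continuous (untwist ε M) := by
  unfold untwist; fun_prop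

lemma continuous_height : Continuous (height w ε M k) := by
  have := continuous_untwist (ε := ε) (M := M)
  unfold height cutoff; fun_prop

lemma untwist_wiggle (z : Circle) : untwist ε M (wiggle w ε M k z) = z := by
  simp [untwist, wiggle]

lemma wiggle_injective : Function.Injective (wiggle w ε M k) :=
  Function.LeftInverse.injective (g := untwist ε M) untwist_wiggle

lemma cutoff_eq_one (hw : 0 < w) {y : ℝ} (hy : |y| ≤ w / 2) : cutoff w y = 1 := by
  unfold cutoff
  rw [min_eq_left]
  have : 2 * |y| / w ≤ 1 := by rw [div_le_one hw]; linarith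
  linarith

lemma cutoff_le_one (y : ℝ) : cutoff w y ≤ 1 := min_le_left _ _

lemma cutoff_nonneg (hw : 0 < w) {y : ℝ} (hy : |y| ≤ w) : 0 ≤ cutoff w y := by
  refine le_min zero_le_one ?_
  have : 2 * |y| / w ≤ 2 := by rw [div_le_iff₀ hw]; linarith
  linarith

lemma abs_wiggle_snd_le (hw : 0 < w) (z : Circle) : |(wiggle w ε M k z).2| ≤ w / 2 := by
  have := abs_im_pow_le_one z k
  simp only [wiggle, abs_mul, abs_of_pos (half_pos hw)]
  nlinarith

lemma abs_bump_le (hw : 0 < w) {q : Circle × ℝ} (hq : |q.2| ≤ w) :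
    |cutoff w q.2 * (w / 2 * ((untwist ε M q : ℂ) ^ k).im)| ≤ cutoff w q.2 * (w / 2) := by
  have h := abs_im_pow_le_one (untwist ε M q) k
  rw [abs_mul, abs_mul, abs_of_pos (half_pos hw), abs_of_nonneg (cutoff_nonneg hw hq)]
  have := mul_nonneg (cutoff_nonneg hw hq) (half_pos hw).le
  nlinarith

lemma abs_bump_le' (hw : 0 < w) {q : Circle × ℝ} (hq : |q.2| ≤ w) :
    |cutoff w q.2 * (w / 2 * ((untwist ε M q : ℂ) ^ k).im)| ≤ w / 2 :=
  (abs_bump_le hw hq).trans (by nlinarith [cutoff_le_one (w := w) q.2])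

lemma height_of_abs_le (hw : 0 < w) {q : Circle × ℝ} (hq : |q.2| ≤ w / 2) :
    height w ε M k q = q.2 - w / 2 * ((untwist ε M q : ℂ) ^ k).im := by
  rw [height, cutoff_eq_one hw hq, one_mul]

lemma eq_wiggle_of_height_eq_zero (hw : 0 < w) {q : Circle × ℝ} (hq : |q.2| ≤ w)
    (h : height w ε M k q = 0) : q = wiggle w ε M k (untwist ε M q) := by
  have h1 : |q.2| ≤ w / 2 := by
    rw [height, sub_eq_zero] at h
    exact (congrArg abs h).trans_le (abs_bump_le' hw hq)
  rw [height_of_abs_le hw h1, sub_eq_zero] at h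
  refine Prod.ext ?_ h
  simp only [wiggle, ← h]
  simp [untwist]

/-- The slope of `cutoff` gives `cutoff w y * (w / 2) ≤ w - |y|`. This keeps `straighten` inside the
closed cylinder, where `E` is injective. -/
lemma abs_height_le (hw : 0 < w) {q : Circle × ℝ} (hq : |q.2| ≤ w) :
    |height w ε M k q| ≤ w := by
  have h1 := abs_bump_le (ε := ε) (M := M) (k := k) hw hq
  have h2 : cutoff w q.2 * (w / 2) ≤ w - |q.2| := by
    have h3 : cutoff w q.2 ≤ 2 - 2 * |q.2| / w := min_le_right _ _
    calc _ ≤ (2 - 2 * |q.2| / w) * (w / 2) := by gcongr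
      _ = _ := by field_simp
  have := abs_sub q.2 (cutoff w q.2 * (w / 2 * ((untwist ε M q : ℂ) ^ k).im))
  unfold height
  linarith

lemma height_of_abs_eq (hw : 0 < w) {q : Circle × ℝ} (hq : |q.2| = w) :
    height w ε M k q = q.2 := by
  have : cutoff w q.2 = 0 := by
    rw [cutoff, hq, mul_div_assoc, div_self hw.ne']; norm_num
  simp [height, this]

/-- Together with `height_of_abs_eq`, this makes straightening fix the boundary of the cylinder, so
that it glues with the identity outside. -/
lemma untwist_of_abs_eq (hM : Real.sin (M * w) = 0) {q : Circle × ℝ} (hq : |q.2| = w) :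
    untwist ε M q = q.1 := by
  have : Real.sin (M * q.2) = 0 := by
    rcases abs_choice q.2 with h | h
    · rw [← h, hq, hM]
    · rw [show q.2 = -w by linarith, mul_neg, Real.sin_neg, hM, neg_zero]
  simp [untwist, this]

/-- The half turn of the cylinder. -/
def flip (q : Circle × ℝ) : Circle × ℝ := (q.1⁻¹, -q.2)

lemma flip_flip (q : Circle × ℝ) : flip (flip q) = q := by simp [flip]

lemma continuous_flip : Continuous flip := by unfold flip; fun_prop

/-- The sinusoid and the shear are both odd, so the half turn preserves the curve. -/
lemma flip_wiggle (z : Circle) : flip (wiggle w ε M k z) = wiggle w ε M k z⁻¹ := by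
  have h : (((z⁻¹ : Circle) : ℂ) ^ k).im = -((z : ℂ) ^ k).im := by
    rw [Circle.coe_inv_eq_conj, ← map_pow, Complex.conj_im]
  simp [flip, wiggle, -Circle.coe_inv, h, mul_comm]

end Wiggle

/-! ### Confinement of circle-valued paths -/

/-- A path in the circle avoiding the `k`-th roots of a point of the circle moves by an angle of
at most `2 * π / k`. -/
lemma exists_angle_le_of_pow_ne {k : ℕ} (hk : 0 < k) {a b : ℝ} {u : ℝ → Circle}
    (hu : ContinuousOn u (Set.Icc a b)) (c : Circle) (h : ∀ t ∈ Set.Icc a b, u t ^ k ≠ c) {s t : ℝ}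
    (hs : s ∈ Set.Icc a b) (ht : t ∈ Set.Icc a b) :
    ∃ r : ℝ, |r| ≤ 2 * Real.pi / k ∧ u t = u s * Circle.exp r := by
  have hk' : (0 : ℝ) < k := by exact_mod_cast hk
  obtain ⟨p, hp⟩ : ∃ p : Circle, p ^ k = c :=
    ⟨Circle.exp ((c : ℂ).arg / k), by
      rw [← Circle.exp_natCast_mul, mul_div_cancel₀ _ hk'.ne', Circle.exp_arg]⟩
  -- Since `u` misses `p`, the point `-(u t / p)` misses the branch cut of `arg`, so `α` is a
  -- continuous angle.
  let α : ℝ → ℝ := fun t => ((-(u t / p) : Circle) : ℂ).arg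
  have hexp : ∀ t, Circle.exp (α t) = -(u t / p) := fun t => Circle.exp_arg _
  have hα : ContinuousOn α (Set.Icc a b) := by
    intro t ht
    refine ContinuousAt.comp_continuousWithinAt (f := fun t => ((-(u t / p) : Circle) : ℂ))
      (g := Complex.arg) (Complex.continuousAt_arg ?_) ?_
    · rw [Complex.mem_slitPlane_iff_arg]
      refine ⟨fun h1 => h t ht ?_, Circle.coe_ne_zero _⟩
      have h2 : -(u t / p) = -1 := by
        rw [← Circle.exp_arg (-(u t / p)), h1]; ext; simp
      rw [← hp, div_eq_one.1 (neg_injective h2)]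
    · have h1 : ContinuousOn (fun t => ((u t : Circle) : ℂ)) (Set.Icc a b) :=
        continuous_subtype_val.comp_continuousOn hu
      exact (h1.div_const (p : ℂ)).neg t ht
  have key : ∀ s ∈ Set.Icc a b, ∀ t ∈ Set.Icc a b, α t - α s ≤ 2 * Real.pi / k := by
    intro s hs t ht
    by_contra! hlt
    -- choose an angle `x` between `α s` and `α t` with `exp (k * (x + π)) = 1`
    set m : ℤ := ⌈(α s + Real.pi) * k / (2 * Real.pi)⌉ with hm
    have hpi := Real.pi_pos
    have h1 : (α s + Real.pi) * k / (2 * Real.pi) ≤ m := Int.le_ceil _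
    have h2 : (m : ℝ) < (α s + Real.pi) * k / (2 * Real.pi) + 1 := Int.ceil_lt_add_one _
    rw [div_le_iff₀ (by positivity)] at h1
    rw [← sub_lt_iff_lt_add, lt_div_iff₀ (by positivity)] at h2
    rw [div_lt_iff₀ hk'] at hlt
    set x : ℝ := m * (2 * Real.pi) / k - Real.pi with hx
    have hkx : x * k = m * (2 * Real.pi) - Real.pi * k := by rw [hx]; field_simp
    have hx1 : α s ≤ x := le_of_mul_le_mul_right (by rw [hkx]; linarith) hk'
    have hx2 : x ≤ α t := le_of_mul_le_mul_right (by rw [hkx]; nlinarith) hk'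
    have hsub : Set.uIcc s t ⊆ Set.Icc a b := Set.ordConnected_Icc.uIcc_subset hs ht
    obtain ⟨y, hy, hyx⟩ := intermediate_value_uIcc (hα.mono hsub)
      (Set.Icc_subset_uIcc ⟨hx1, hx2⟩ : x ∈ Set.uIcc (α s) (α t))
    refine h y (hsub hy) ?_
    have h3 : u y / p = Circle.exp (x + Real.pi) := by
      rw [Circle.exp_add, ← hyx, hexp]; ext; simp
    have h4 : (u y / p) ^ k = 1 := by
      rw [h3, ← Circle.exp_natCast_mul, Circle.exp_eq_one]
      exact ⟨m, by rw [hx]; field_simp; ring⟩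
    rw [div_pow, div_eq_one, hp] at h4
    exact h4
  refine ⟨α t - α s, abs_sub_le_iff.2 ⟨key s hs t ht, key t ht s hs⟩, ?_⟩
  rw [Circle.exp_sub, hexp, hexp]
  ext
  have := (u s).coe_ne_zero
  simp

/-! ### Last crossing times -/

/-- Last time in `[a, b]` at which `f` is at least `c`. -/
def lastTime (f : ℝ → ℝ) (a b c : ℝ) : ℝ := sSup {t ∈ Set.Icc a b | c ≤ f t}

section lastTime

variable {f : ℝ → ℝ} {a b c d : ℝ}

/-- The bound `c ≤ f a` makes the set nonempty, so `sSup` is a maximum and not the default value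
`0`. -/
lemma lastTime_mem (hab : a ≤ b) (hf : ContinuousOn f (Set.Icc a b)) (ha : c ≤ f a) :
    lastTime f a b c ∈ {t ∈ Set.Icc a b | c ≤ f t} := by
  have hcl : IsClosed {t ∈ Set.Icc a b | c ≤ f t} :=
    isClosed_Icc.isClosed_le continuousOn_const hf
  exact hcl.csSup_mem ⟨a, ⟨le_rfl, hab⟩, ha⟩ ⟨b, fun t ht => ht.1.2⟩

lemma lt_of_lastTime_lt {t : ℝ} (hlt : lastTime f a b c < t) (hat : a ≤ t) (htb : t ≤ b) :
    f t < c := by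
  by_contra! h
  exact hlt.not_ge (le_csSup ⟨b, fun t ht => ht.1.2⟩ ⟨⟨hat, htb⟩, h⟩)

lemma apply_lastTime (hab : a ≤ b) (hf : ContinuousOn f (Set.Icc a b)) (ha : c ≤ f a)
    (hb : f b ≤ c) : f (lastTime f a b c) = c := by
  obtain ⟨⟨h1, h2⟩, h3⟩ := lastTime_mem hab hf ha
  obtain ⟨t, ht, htc⟩ := intermediate_value_Icc' h2 (hf.mono (Set.Icc_subset_Icc_left h1)) ⟨hb, h3⟩
  have : t ≤ lastTime f a b c :=
    le_csSup ⟨b, fun t ht => ht.1.2⟩ ⟨⟨h1.trans ht.1, ht.2⟩, htc.ge⟩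
  rw [le_antisymm ht.1 this, htc]

lemma lastTime_anti (hab : a ≤ b) (hf : ContinuousOn f (Set.Icc a b)) (hd : d ≤ f a)
    (hcd : c ≤ d) : lastTime f a b d ≤ lastTime f a b c := by
  obtain ⟨h1, h3⟩ := lastTime_mem hab hf hd
  exact le_csSup ⟨b, fun t ht => ht.1.2⟩ ⟨h1, hcd.trans h3⟩

end lastTime

/-! ### Collars -/

/-- The closed cylinder of half-height `w`. -/
def cylinder (w : ℝ) : Set (Circle × ℝ) := {q | |q.2| ≤ w}

/-- The open cylinder of half-height `w`. -/
def openCylinder (w : ℝ) : Set (Circle × ℝ) := {q | |q.2| < w}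

lemma isCompact_cylinder (w : ℝ) : IsCompact (cylinder w) := by
  have : cylinder w = Set.univ ×ˢ Set.Icc (-w) w := by ext q; simp [cylinder, abs_le]
  rw [this]
  exact isCompact_univ.prod isCompact_Icc

lemma openCylinder_subset (w : ℝ) : openCylinder w ⊆ cylinder w :=
  fun q (h : |q.2| < w) => show |q.2| ≤ w from h.le

/-- `E` parametrizes a two-sided collar of half-width `w` of the curve `E (·, 0)`. -/
structure IsCollar {X : Type*} [TopologicalSpace X] (E : Circle × ℝ → X) (w : ℝ) : Prop where
  pos : 0 < w
  continuous : Continuous E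
  injOn : Set.InjOn E (cylinder w)
  isOpen : IsOpen (E '' openCylinder w)

namespace IsCollar

/-! ### Straightening the serpentine and transfer of separation. -/

section Topology

/-- Cylinder coordinates of a point of the collar. -/
def coords {X : Type*} (E : Circle × ℝ → X) (w : ℝ) : X → Circle × ℝ :=
  Function.invFunOn E (cylinder w)

open Classical in
/-- The map of `X` that is the identity off the collar and straightens the serpentine curve. -/
def straighten {X : Type*} (E : Circle × ℝ → X) (w ε M : ℝ) (k : ℕ) : X → X :=
  (E '' openCylinder w).piecewise
    (fun x => E (untwist ε M (coords E w x), height w ε M k (coords E w x))) id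

lemma straighten_of_notMem {X : Type*} {E : Circle × ℝ → X} {w ε M : ℝ} {k : ℕ} {x : X}
    (hx : x ∉ E '' openCylinder w) :
    straighten E w ε M k x = x := by
  classical exact Set.piecewise_eq_of_notMem _ _ _ hx

variable {X : Type*} [TopologicalSpace X] {E : Circle × ℝ → X} {w ε M : ℝ} {k : ℕ}

lemma flip (hE : IsCollar E w) : IsCollar (E ∘ flip) w where
  pos := hE.pos
  continuous := hE.continuous.comp continuous_flip
  injOn := by
    intro q hq q' hq' h
    have := @hE.injOn (JordanResistance.flip q)
      (by simpa [cylinder, JordanResistance.flip] using hq) (JordanResistance.flip q')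
      (by simpa [cylinder, JordanResistance.flip] using hq') h
    rw [← flip_flip q, this, flip_flip]
  isOpen := by
    have : JordanResistance.flip '' openCylinder w = openCylinder w := by
      rw [Set.image_eq_preimage_of_inverse (g := JordanResistance.flip) flip_flip flip_flip]
      ext q; simp [openCylinder, JordanResistance.flip]
    rw [Set.image_comp, this]
    exact hE.isOpen

lemma coords_apply (hE : IsCollar E w) {q : Circle × ℝ} (hq : q ∈ cylinder w) :
    coords E w (E q) = q :=
  hE.injOn.leftInvOn_invFunOn hq

lemma straighten_apply (hE : IsCollar E w) {q : Circle × ℝ} (hq : q ∈ openCylinder w) :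
    straighten E w ε M k (E q) = E (untwist ε M q, height w ε M k q) := by
  have h : E q ∈ E '' openCylinder w := ⟨q, hq, rfl⟩
  classical rw [straighten, Set.piecewise_eq_of_mem _ _ _ h,
    hE.coords_apply (openCylinder_subset w hq)]

/-- Connected sets off the serpentine thus have straightened images off the base curve, which is all
that the separation arguments need. -/
lemma mem_of_straighten_mem (hE : IsCollar E w) {x : X}
    (hx : straighten E w ε M k x ∈ Set.range fun z => E (z, 0)) :
    x ∈ Set.range fun z => E (wiggle w ε M k z) := by
  have h0 : ∀ z : Circle, (z, (0 : ℝ)) ∈ openCylinder w := fun z => by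
    simpa [openCylinder] using hE.pos
  obtain ⟨z, hz⟩ := hx
  by_cases hxU : x ∈ E '' openCylinder w
  · obtain ⟨q, hq, rfl⟩ := hxU
    have hq' := openCylinder_subset w hq
    rw [hE.straighten_apply hq] at hz
    have h := hE.injOn (openCylinder_subset w (h0 z)) (abs_height_le hE.pos hq') hz
    exact ⟨untwist ε M q,
      congrArg E (eq_wiggle_of_height_eq_zero hE.pos hq' (Prod.ext_iff.1 h).2.symm).symm⟩
  · rw [straighten_of_notMem hxU] at hz
    exact absurd ⟨_, h0 z, hz⟩ hxU

variable [T2Space X]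

lemma isClosed (hE : IsCollar E w) : IsClosed (E '' cylinder w) :=
  ((isCompact_cylinder w).image hE.continuous).isClosed

/-- A continuous injection of a compact space into a Hausdorff space is a closed embedding. -/
lemma continuousOn_coords (hE : IsCollar E w) :
    ContinuousOn (coords E w) (E '' cylinder w) := by
  rw [continuousOn_iff_isClosed]
  intro t ht
  refine ⟨E '' (cylinder w ∩ t),
    (((isCompact_cylinder w).inter_right ht).image hE.continuous).isClosed, ?_⟩
  ext x
  constructor
  · rintro ⟨hx, q, hq, rfl⟩
    rw [Set.mem_preimage, hE.coords_apply hq] at hx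
    exact ⟨⟨q, ⟨hq, hx⟩, rfl⟩, q, hq, rfl⟩
  · rintro ⟨⟨q, ⟨hq, hx⟩, rfl⟩, -⟩
    exact ⟨by rwa [Set.mem_preimage, hE.coords_apply hq], q, hq, rfl⟩

lemma closure_subset (hE : IsCollar E w) : closure (E '' openCylinder w) ⊆ E '' cylinder w :=
  closure_minimal (Set.image_mono (openCylinder_subset w)) hE.isClosed

lemma continuous_straighten (hE : IsCollar E w) (hM : Real.sin (M * w) = 0) :
    Continuous (straighten E w ε M k) := by
  classical
  rw [← continuousOn_univ]
  refine ContinuousOn.piecewise ?_ ?_ continuousOn_id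
  · rintro x ⟨-, hx⟩
    rw [hE.isOpen.frontier_eq] at hx
    obtain ⟨q, hq, rfl⟩ := hE.closure_subset hx.1
    have hqw : |q.2| = w := by
      refine le_antisymm hq (not_lt.1 fun h => hx.2 ⟨q, h, rfl⟩)
    rw [hE.coords_apply hq, untwist_of_abs_eq hM hqw, height_of_abs_eq hE.pos hqw]
    rfl
  · rw [Set.univ_inter]
    have h := hE.continuousOn_coords.mono hE.closure_subset
    exact hE.continuous.comp_continuousOn
      ((continuous_untwist.comp_continuousOn h).prodMk (continuous_height.comp_continuousOn h))

lemma wiggle_mem_openCylinder (hw : 0 < w) (z : Circle) : wiggle w ε M k z ∈ openCylinder w :=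
  (abs_wiggle_snd_le hw z).trans_lt (half_lt_self hw)

/-- No connected set off the serpentine curve joins two points separated by the base curve. -/
lemma notMem_of_isPreconnected (hE : IsCollar E w) (hM : Real.sin (M * w) = 0) {p q : X}
    (hp : p ∉ E '' openCylinder w) (hq : q ∉ E '' openCylinder w)
    (hsep : q ∉ connectedComponentIn (Set.range fun z => E (z, 0))ᶜ p) {s : Set X}
    (hs : IsPreconnected s) (hps : p ∈ s)
    (hsK : Disjoint s (Set.range fun z => E (wiggle w ε M k z))) : q ∉ s := by
  intro hqs
  have hc : Continuous (straighten E w ε M k) := hE.continuous_straighten hM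
  refine hsep ((hs.image _ hc.continuousOn).subset_connectedComponentIn
    ⟨p, hps, straighten_of_notMem hp⟩ ?_ ⟨q, hqs, straighten_of_notMem hq⟩)
  rintro _ ⟨x, hx, rfl⟩ hxJ
  exact Set.disjoint_left.1 hsK hx (hE.mem_of_straighten_mem hxJ)

end Topology

/-! ### The final entry of a path into the collar. -/

section Descent

variable {X : Type*} [TopologicalSpace X] [T2Space X] {E : Circle × ℝ → X} {w ε M : ℝ} {k : ℕ}

/-- A path entering the collar and ending on the serpentine curve without visiting the side of
negative height has a final piece in the collar that starts on the upper boundary. -/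
lemma exists_last_entry (hE : IsCollar E w) {γ : ℝ → X} (hγ : Continuous γ)
    {b : ℝ} (hb : 0 ≤ b) (h0 : γ 0 ∉ E '' openCylinder w) (hbU : γ b ∈ E '' openCylinder w)
    (hpos : ∀ t ∈ Set.Ico 0 b, ∀ q ∈ openCylinder w, γ t = E q → 0 ≤ height w ε M k q) :
    ∃ a ∈ Set.Ico 0 b, (∀ t ∈ Set.Icc a b, γ t ∈ E '' cylinder w) ∧
      (coords E w (γ a)).2 = w ∧ ∀ t ∈ Set.Icc a b, 0 ≤ height w ε M k (coords E w (γ t)) := by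
  set S : Set ℝ := Set.Icc 0 b ∩ γ ⁻¹' (E '' openCylinder w)ᶜ with hS
  have hScl : IsClosed S := isClosed_Icc.inter (hE.isOpen.isClosed_compl.preimage hγ)
  have hSb : BddAbove S := ⟨b, fun t ht => ht.1.2⟩
  obtain ⟨⟨ha0, hab⟩, haU⟩ : sSup S ∈ S := hScl.csSup_mem ⟨0, ⟨le_rfl, hb⟩, h0⟩ hSb
  set a := sSup S with ha
  have hab' : a < b := lt_of_le_of_ne hab fun h => haU (show γ a ∈ _ by rwa [h])
  have hU : ∀ t ∈ Set.Ioc a b, γ t ∈ E '' openCylinder w := fun t ht => by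
    by_contra h
    exact ht.1.not_ge (le_csSup hSb ⟨⟨ha0.trans ht.1.le, ht.2⟩, h⟩)
  have hcl : ∀ t ∈ Set.Icc a b, γ t ∈ E '' cylinder w := by
    intro t ht
    have hsub : γ '' Set.Ioc a b ⊆ E '' openCylinder w := by
      rintro _ ⟨s, hs, rfl⟩; exact hU s hs
    refine hE.closure_subset (closure_mono hsub
      (image_closure_subset_closure_image hγ ⟨t, ?_, rfl⟩))
    rwa [closure_Ioc hab'.ne]
  have hg : ContinuousOn (fun t => coords E w (γ t)) (Set.Icc a b) :=
    hE.continuousOn_coords.comp hγ.continuousOn hcl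
  have hh : ∀ t ∈ Set.Icc a b, 0 ≤ height w ε M k (coords E w (γ t)) := by
    have h1 : IsClosed {t ∈ Set.Icc a b | 0 ≤ height w ε M k (coords E w (γ t))} :=
      isClosed_Icc.isClosed_le continuousOn_const (continuous_height.comp_continuousOn hg)
    have h2 : Set.Ioo a b ⊆ {t ∈ Set.Icc a b | 0 ≤ height w ε M k (coords E w (γ t))} := by
      intro t ht
      refine ⟨Set.Ioo_subset_Icc_self ht, ?_⟩
      obtain ⟨q, hq, hqt⟩ := hU t ⟨ht.1, ht.2.le⟩
      rw [← hqt, hE.coords_apply (openCylinder_subset w hq)]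
      exact hpos t ⟨ha0.trans ht.1.le, ht.2⟩ q hq hqt.symm
    intro t ht
    rw [← closure_Ioo hab'.ne] at ht
    exact (closure_minimal h2 h1 ht).2
  refine ⟨a, ⟨ha0, hab'⟩, hcl, ?_, hh⟩
  have haI : a ∈ Set.Icc a b := ⟨le_rfl, hab⟩
  obtain ⟨q, hq, hqa⟩ := hcl a haI
  have hqw : |q.2| = w :=
    le_antisymm hq (not_lt.1 fun h => haU ⟨q, h, hqa⟩)
  -- On the boundary the height is `y` itself, so nonnegativity rules out `y = -w`.
  have h1 := hh a haI
  rw [← hqa, hE.coords_apply hq] at h1 ⊢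
  rw [height_of_abs_eq hE.pos hqw] at h1
  rwa [abs_of_nonneg h1] at hqw

end Descent

/-! ### Length estimates. -/

section Length

variable {X : Type*} [MetricSpace X] {E : Circle × ℝ → X} {w ε M : ℝ} {k : ℕ}

/-- Descending along a channel of the serpentine curve takes a long way. -/
lemma le_eVariationOn (hE : IsCollar E w) {m : ℕ} (hM : M = (4 * (m + 1)) * Real.pi / w)
    (hε : 0 < ε) (hk : 0 < k) (hkε : 2 * Real.pi / k ≤ ε) {η : ENNReal}
    (hη : ∀ q ∈ cylinder w, ∀ q' ∈ cylinder w, ∀ r : ℝ, ε ≤ |r| → |r| ≤ 3 * ε →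
      q'.1 = q.1 * Circle.exp r → η ≤ edist (E q) (E q'))
    {γ : ℝ → X} (hγ : Continuous γ) {b : ℝ} (hb : 0 ≤ b) (h0 : γ 0 ∉ E '' openCylinder w)
    {z₀ : Circle} (hγb : γ b = E (wiggle w ε M k z₀)) (hz₀ : (wiggle w ε M k z₀).2 ≤ 0)
    (hpos : ∀ t ∈ Set.Ico 0 b, ∀ q ∈ openCylinder w, γ t = E q → 0 ≤ height w ε M k q) :
    m * η ≤ eVariationOn γ (Set.Icc 0 b) := by
  have hw := hE.pos
  have hwU := wiggle_mem_openCylinder (ε := ε) (M := M) (k := k) hw z₀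
  obtain ⟨a, ha, hcl, haw, hh⟩ := hE.exists_last_entry hγ hb h0 ⟨_, hwU, hγb.symm⟩ hpos
  set g : ℝ → Circle × ℝ := fun t => coords E w (γ t) with hg_def
  have hg : ContinuousOn g (Set.Icc a b) := hE.continuousOn_coords.comp hγ.continuousOn hcl
  have hEg : ∀ t ∈ Set.Icc a b, E (g t) = γ t := fun t ht => by
    obtain ⟨q, hq, hqt⟩ := hcl t ht
    simp only [hg_def]
    rw [← hqt]
    exact congrArg E (hE.coords_apply hq)
  have hgc : ∀ t ∈ Set.Icc a b, g t ∈ cylinder w := fun t ht => by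
    obtain ⟨q, hq, hqt⟩ := hcl t ht
    simp only [hg_def, ← hqt, hE.coords_apply hq, hq]
  set y : ℝ → ℝ := fun t => (g t).2 with hy_def
  have hy : ContinuousOn y (Set.Icc a b) := continuous_snd.comp_continuousOn hg
  have hya : y a = w := haw
  have hyb : y b ≤ 0 := by
    simp only [hy_def, hg_def, hγb, hE.coords_apply (openCylinder_subset w hwU), hz₀]
  have hab := ha.2.le
  -- From this time on the path stays well below the crests, which are at `y = w / 2`.
  set a' := lastTime y a b (w / 4) with ha'
  have ha'm := lastTime_mem (c := w / 4) hab hy (by linarith)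
  have ha'b : Set.Icc a' b ⊆ Set.Icc a b := Set.Icc_subset_Icc_left ha'm.1.1
  have hya' : ∀ t ∈ Set.Icc a' b, y t ≤ w / 4 := by
    intro t ht
    rcases ht.1.eq_or_lt with h | h
    · rw [← h]; exact (apply_lastTime hab hy (by linarith) (by linarith)).le
    · exact (lt_of_lastTime_lt h (ha'b ht).1 ht.2).le
  -- The crests are where the `k`-th power is `i`; nonnegative height there would force `y ≥ w / 2`.
  have hconf : ∀ t ∈ Set.Icc a' b, untwist ε M (g t) ^ k ≠ Circle.exp (Real.pi / 2) := by
    intro t ht h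
    have h1 : |(g t).2| ≤ w / 2 := by
      have h2 := abs_bump_le' (ε := ε) (M := M) (k := k) hw (hgc t (ha'b ht))
      have h3 := hh t (ha'b ht)
      have h4 := hya' t ht
      have h5 := (abs_le.1 h2).1
      simp only [height] at h3
      exact abs_le.2 ⟨by linarith, by simp only [hy_def] at h4; linarith⟩
    have h2 := hh t (ha'b ht)
    change 0 ≤ height w ε M k (g t) at h2
    rw [height_of_abs_le hw h1] at h2
    have h3 : ((untwist ε M (g t) : ℂ) ^ k).im = 1 := by
      rw [← Circle.coe_pow, h, Circle.coe_exp]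
      push_cast
      rw [Complex.exp_pi_div_two_mul_I, Complex.I_im]
    rw [h3] at h2
    have := hya' t ht
    simp only [hy_def] at this
    linarith
  -- These are the levels `(j + 1 / 2) * π / M`, extrema of `sin (M * y)`; `c 0, ..., c m` lie in
  -- `[0, w / 4]` and bound `m` swings.
  let c : ℕ → ℝ := fun j => (j + 1 / 2) * (w / (4 * (m + 1)))
  have hc0 : ∀ j, 0 ≤ c j := fun j => by positivity
  have hcm : ∀ j ≤ m, c j ≤ w / 4 := by
    intro j hj
    have hj' : (j : ℝ) ≤ m := by exact_mod_cast hj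
    calc c j ≤ (m + 1) * (w / (4 * (m + 1))) := by
          simp only [c]; gcongr; linarith
      _ = w / 4 := by field_simp
  have hcmono : Monotone c := by
    intro i j hij
    have hij' : (i : ℝ) ≤ j := by exact_mod_cast hij
    simp only [c]; gcongr
  have hsin : ∀ j, Real.sin (M * c j) = (-1) ^ j := by
    intro j
    have : M * c j = Real.pi / 2 + j * Real.pi := by
      simp only [hM, c]; field_simp; ring
    rw [this, Real.sin_add_nat_mul_pi, Real.sin_pi_div_two, mul_one]
  -- Levels are listed downwards so that the times increase; for `i > m` truncated subtraction just
  -- repeats level `c 0`.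
  let u : ℕ → ℝ := fun i => lastTime y a b (c (m - i))
  have hcw : ∀ i, c (m - i) ≤ w / 4 := fun i => hcm _ (Nat.sub_le _ _)
  have huI : ∀ i, u i ∈ Set.Icc a' b := fun i =>
    ⟨lastTime_anti hab hy (by linarith) (hcw i),
      (lastTime_mem hab hy (by linarith [hcw i])).1.2⟩
  have hyu : ∀ i, (g (u i)).2 = c (m - i) := fun i =>
    apply_lastTime hab hy (by linarith [hcw i]) (hyb.trans (hc0 _))
  have humono : Monotone u := fun i j hij =>
    lastTime_anti hab hy (by linarith [hcw i]) (hcmono (by omega))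
  have hfst : ∀ q : Circle × ℝ,
      q.1 = untwist ε M q * Circle.exp (ε * Real.sin (M * q.2)) := fun q => by simp [untwist]
  have hstep : ∀ i ∈ Finset.range m, η ≤ edist (γ (u (i + 1))) (γ (u i)) := by
    intro i hi
    rw [Finset.mem_range] at hi
    rw [← hEg _ (ha'b (huI _)), ← hEg _ (ha'b (huI _))]
    obtain ⟨ρ, hρ, hρu⟩ := exists_angle_le_of_pow_ne hk
      (continuous_untwist.comp_continuousOn (hg.mono ha'b)) _ hconf (huI (i + 1)) (huI i)
    have hρε := hρ.trans hkε
    simp only [Function.comp_apply] at hρu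
    have hj : m - i = m - (i + 1) + 1 := by omega
    set j := m - (i + 1) with hj_def
    -- The turn combines the confined angle `ρ`, with `|ρ| ≤ ε`, and a swing of `2 * ε` of the
    -- shear, so its size lies in `[ε, 3 * ε]`.
    have hrat : (g (u i)).1 = (g (u (i + 1))).1 * Circle.exp (ρ - 2 * ε * (-1) ^ j) := by
      rw [hfst (g (u i)), hfst (g (u (i + 1))), hyu, hyu, ← hj_def, hj, hsin, hsin, hρu,
        mul_assoc, mul_assoc, ← Circle.exp_add, ← Circle.exp_add]
      congr 2
      ring
    have hρ' := abs_le.1 hρε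
    refine hη _ (hgc _ (ha'b (huI _))) _ (hgc _ (ha'b (huI _))) _ ?_ ?_ hrat
    · rcases neg_one_pow_eq_or ℝ j with h | h <;> rw [h, le_abs]
      · right; linarith
      · left; linarith
    · rcases neg_one_pow_eq_or ℝ j with h | h <;> rw [h, abs_le] <;> constructor <;> linarith
  calc (m : ENNReal) * η = ∑ i ∈ Finset.range m, η := by simp
    _ ≤ ∑ i ∈ Finset.range m, edist (γ (u (i + 1))) (γ (u i)) := Finset.sum_le_sum hstep
    _ ≤ eVariationOn γ (Set.Icc 0 b) := eVariationOn.sum_le humono fun i =>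
      Set.Icc_subset_Icc_left ha.1 (ha'b (huI i))

/-- Points of a collar with circle coordinates at a definite distance are at a definite
distance. -/
lemma exists_le_edist (hE : IsCollar E w) (hε : 0 < ε) (hε1 : ε ≤ 1) :
    ∃ η : ℝ, 0 < η ∧ ∀ q ∈ cylinder w, ∀ q' ∈ cylinder w, ∀ r : ℝ, ε ≤ |r| → |r| ≤ 3 * ε →
      q'.1 = q.1 * Circle.exp r → ENNReal.ofReal η ≤ edist (E q) (E q') := by
  let P : Set ((Circle × ℝ) × (Circle × ℝ) × ℝ) :=
    (cylinder w ×ˢ cylinder w ×ˢ Set.Icc (-(3 * ε)) (3 * ε)) ∩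
      {p | ε ≤ |p.2.2| ∧ p.2.1.1 = p.1.1 * Circle.exp p.2.2}
  have hP : IsCompact P := by
    refine ((isCompact_cylinder w).prod ((isCompact_cylinder w).prod isCompact_Icc)).inter_right ?_
    have h1 : IsClosed {p : (Circle × ℝ) × (Circle × ℝ) × ℝ | ε ≤ |p.2.2|} :=
      isClosed_le (by fun_prop) (by fun_prop)
    have h2 : IsClosed {p : (Circle × ℝ) × (Circle × ℝ) × ℝ |
        p.2.1.1 = p.1.1 * Circle.exp p.2.2} := isClosed_eq (by fun_prop) (by fun_prop)
    exact h1.inter h2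
  have hc : Continuous fun p : (Circle × ℝ) × (Circle × ℝ) × ℝ => dist (E p.1) (E p.2.1) :=
    (hE.continuous.comp continuous_fst).dist
      (hE.continuous.comp (continuous_fst.comp continuous_snd))
  obtain ⟨η, hη, h⟩ : ∃ η : ℝ, 0 < η ∧ ∀ p ∈ P, η ≤ dist (E p.1) (E p.2.1) := by
    refine hP.exists_forall_le' hc.continuousOn ?_
    rintro ⟨q, q', r⟩ ⟨⟨hq, hq', hr⟩, hrε, hrat⟩
    refine dist_pos.2 fun heq => ?_
    have := hE.injOn hq hq' heq
    simp only at this hrε hrat hr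
    rw [this, left_eq_mul, ← Circle.exp_zero] at hrat
    -- Both `r` and `0` lie in an interval of length `6 * ε ≤ 6 < 2 * π`, on which `Circle.exp` is
    -- injective.
    have hpi := Real.pi_gt_three
    have h0 : r = 0 := Circle.exp_injOn_Icc (a := -(3 * ε)) (b := 3 * ε) (by linarith) hr
      ⟨by linarith, by linarith⟩ hrat
    rw [h0, abs_zero] at hrε
    linarith
  refine ⟨η, hη, fun q hq q' hq' r hr hr' hrat => ?_⟩
  rw [edist_dist]
  exact ENNReal.ofReal_le_ofReal (h (q, q', r) ⟨⟨hq, hq', abs_le.1 hr'⟩, hr, hrat⟩)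

lemma isPreconnected_lower (hE : IsCollar E w) :
    IsPreconnected (E '' (Set.univ ×ˢ Set.Ico (-w) 0)) :=
  (isPreconnected_univ.prod isPreconnected_Ico).image _ hE.continuous.continuousOn

lemma straighten_mem_lower (hE : IsCollar E w) {q : Circle × ℝ} (hq : q ∈ openCylinder w)
    (hneg : height w ε M k q < 0) :
    straighten E w ε M k (E q) ∈ E '' (Set.univ ×ˢ Set.Ico (-w) 0) := by
  rw [hE.straighten_apply hq]
  exact ⟨_, ⟨trivial, (abs_le.1 (abs_height_le hE.pos (openCylinder_subset w hq))).1, hneg⟩, rfl⟩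

lemma lower_subset (hE : IsCollar E w) :
    E '' (Set.univ ×ˢ Set.Ico (-w) 0) ⊆ (Set.range fun z => E (z, 0))ᶜ := by
  rintro _ ⟨⟨z, y⟩, ⟨-, hy1, hy2⟩, rfl⟩ ⟨z', hz'⟩
  have := hE.injOn (x₁ := (z', 0)) (by simpa [cylinder] using hE.pos.le)
    (x₂ := (z, y)) (abs_le.2 ⟨hy1, hy2.le.trans hE.pos.le⟩) hz'
  exact hy2.ne (Prod.ext_iff.1 this).2.symm

lemma eVariationOn_extend_le {p q : X} (γ : Path p q) (s : Set ℝ) :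
    eVariationOn γ.extend s ≤ eVariationOn γ Set.univ :=
  eVariationOn.comp_le_of_monotoneOn γ (Set.projIcc 0 1 zero_le_one)
    ((Set.monotone_projIcc _).monotoneOn _) (fun _ _ => trivial)

lemma eVariationOn_extend_symm_le {p q : X} (γ : Path p q) (s : Set ℝ) :
    eVariationOn γ.symm.extend s ≤ eVariationOn γ Set.univ := by
  refine (eVariationOn_extend_le γ.symm s).trans ?_
  exact eVariationOn.comp_le_of_antitoneOn γ unitInterval.symm
    (unitInterval.strictAnti_symm.antitone.antitoneOn _) (fun _ _ => trivial)

/-- A path starting outside the collar and meeting the serpentine curve only in a point of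
nonpositive second coordinate is long, or has an initial piece that avoids the curve and reaches
the lower side. -/
lemma exists_mem_lower (hE : IsCollar E w) {m : ℕ}
    (hM : M = (4 * (m + 1)) * Real.pi / w)
    (hε : 0 < ε) (hk : 0 < k) (hkε : 2 * Real.pi / k ≤ ε) {η : ENNReal}
    (hη : ∀ q ∈ cylinder w, ∀ q' ∈ cylinder w, ∀ r : ℝ, ε ≤ |r| → |r| ≤ 3 * ε →
      q'.1 = q.1 * Circle.exp r → η ≤ edist (E q) (E q'))
    {p q : X} (hp : p ∉ E '' openCylinder w) (γ : Path p q) {z₀ : Circle}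
    (hz₀ : (wiggle w ε M k z₀).2 ≤ 0)
    (hγ : Set.range γ ∩ (Set.range fun z => E (wiggle w ε M k z)) = {E (wiggle w ε M k z₀)})
    (hshort : eVariationOn γ.extend (Set.Icc 0 1) < m * η) :
    ∃ s : Set X, IsPreconnected s ∧ p ∈ s ∧ s ⊆ (Set.range fun z => E (z, 0))ᶜ ∧
      (s ∩ E '' (Set.univ ×ˢ Set.Ico (-w) 0)).Nonempty := by
  have hw := hE.pos
  have hMw : Real.sin (M * w) = 0 := by
    have : M * w = (4 * (m + 1) : ℕ) * Real.pi := by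
      rw [hM]; push_cast; field_simp
    rw [this, Real.sin_nat_mul_pi]
  set K : Set X := Set.range fun z => E (wiggle w ε M k z) with hK
  have hKcl : IsClosed K := (isCompact_range (hE.continuous.comp continuous_wiggle)).isClosed
  -- The infimum of `S` is the first hitting time; before it the straightened path avoids the base
  -- curve.
  set S : Set ℝ := Set.Icc 0 1 ∩ γ.extend ⁻¹' K with hS
  have hScl : IsClosed S := isClosed_Icc.inter (hKcl.preimage γ.extend.continuous)
  have hSne : S.Nonempty := by
    obtain ⟨⟨t, ht⟩, -⟩ := hγ.symm.subset rfl
    refine ⟨t, t.2, ?_⟩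
    rw [Set.mem_preimage, Path.extend_apply γ t.2, ht]
    exact ⟨z₀, rfl⟩
  have hSb : BddBelow S := ⟨0, fun t ht => ht.1.1⟩
  have ht₀ : sInf S ∈ S := hScl.csInf_mem hSne hSb
  set t₀ := sInf S with ht₀_def
  have hbefore : ∀ t ∈ Set.Ico 0 t₀, γ.extend t ∉ K := fun t ht h =>
    ht.2.not_ge (csInf_le hSb ⟨⟨ht.1, ht.2.le.trans ht₀.1.2⟩, h⟩)
  have hx : γ.extend t₀ = E (wiggle w ε M k z₀) := by
    have : γ.extend t₀ ∈ Set.range γ ∩ K :=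
      ⟨⟨⟨t₀, ht₀.1⟩, (Path.extend_apply γ ht₀.1).symm⟩, ht₀.2⟩
    rw [hγ] at this
    exact this
  obtain ⟨t, ht, c, hc, htc, hneg⟩ : ∃ t ∈ Set.Ico 0 t₀, ∃ c ∈ openCylinder w,
      γ.extend t = E c ∧ height w ε M k c < 0 := by
    -- If the height never became negative before the hit, the descent estimate would contradict
    -- shortness.
    by_contra! hcon
    refine hshort.not_ge ((hE.le_eVariationOn hM hε hk hkε hη γ.extend.continuous ht₀.1.1
      (by rwa [Path.extend_zero]) hx hz₀ hcon).trans (eVariationOn.mono _ ?_))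
    exact Set.Icc_subset_Icc_right ht₀.1.2
  refine ⟨straighten E w ε M k '' (γ.extend '' Set.Icc 0 t), ?_, ?_, ?_, ?_⟩
  · exact (isPreconnected_Icc.image _ γ.extend.continuous.continuousOn).image _
      (hE.continuous_straighten hMw).continuousOn
  · exact ⟨p, ⟨0, ⟨le_rfl, ht.1⟩, Path.extend_zero γ⟩, straighten_of_notMem hp⟩
  · rintro _ ⟨_, ⟨s, hs, rfl⟩, rfl⟩ hJ
    exact hbefore s ⟨hs.1, hs.2.trans_lt ht.2⟩ (hE.mem_of_straighten_mem hJ)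
  · refine ⟨_, ⟨_, ⟨t, ⟨ht.1, le_rfl⟩, rfl⟩, rfl⟩, ?_⟩
    rw [htc]
    exact hE.straighten_mem_lower hc hneg

/-- Were the path short, it and its reverse would both lead to the lower side, which is connected
and misses the base curve; this would put `p` and `q` in one component. -/
lemma le_eVariationOn_of_nonpos (hE : IsCollar E w) {m : ℕ}
    (hM : M = (4 * (m + 1)) * Real.pi / w)
    (hε : 0 < ε) (hk : 0 < k) (hkε : 2 * Real.pi / k ≤ ε) {η : ENNReal}
    (hη : ∀ q ∈ cylinder w, ∀ q' ∈ cylinder w, ∀ r : ℝ, ε ≤ |r| → |r| ≤ 3 * ε →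
      q'.1 = q.1 * Circle.exp r → η ≤ edist (E q) (E q'))
    {p q : X} (hp : p ∉ E '' openCylinder w) (hq : q ∉ E '' openCylinder w)
    (hsep : q ∉ connectedComponentIn (Set.range fun z => E (z, 0))ᶜ p)
    (γ : Path p q) {z₀ : Circle} (hz₀ : (wiggle w ε M k z₀).2 ≤ 0)
    (hγ : Set.range γ ∩ (Set.range fun z => E (wiggle w ε M k z)) = {E (wiggle w ε M k z₀)}) :
    m * η ≤ eVariationOn γ Set.univ := by
  by_contra! hshort
  obtain ⟨s, hs, hps, hsJ, x, hxs, hx⟩ := hE.exists_mem_lower hM hε hk hkε hη hp γ hz₀ hγ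
    ((eVariationOn_extend_le γ _).trans_lt hshort)
  obtain ⟨s', hs', hqs', hsJ', x', hxs', hx'⟩ := hE.exists_mem_lower hM hε hk hkε hη hq γ.symm
    hz₀ (by rwa [Path.symm_range]) ((eVariationOn_extend_symm_le γ _).trans_lt hshort)
  have h1 := hs.union x hxs hx hE.isPreconnected_lower
  have h2 := h1.union x' (Or.inr hx') hxs' hs'
  exact hsep (h2.subset_connectedComponentIn (Or.inl (Or.inl hps))
    (Set.union_subset (Set.union_subset hsJ hE.lower_subset) hsJ') (Or.inr hqs'))

/-- A path between separated points that meets the serpentine curve in a single point is long. -/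
theorem le_eVariationOn_path (hE : IsCollar E w) {m : ℕ}
    (hM : M = (4 * (m + 1)) * Real.pi / w)
    (hε : 0 < ε) (hk : 0 < k) (hkε : 2 * Real.pi / k ≤ ε) {η : ENNReal}
    (hη : ∀ q ∈ cylinder w, ∀ q' ∈ cylinder w, ∀ r : ℝ, ε ≤ |r| → |r| ≤ 3 * ε →
      q'.1 = q.1 * Circle.exp r → η ≤ edist (E q) (E q'))
    {p q : X} (hp : p ∉ E '' openCylinder w) (hq : q ∉ E '' openCylinder w)
    (hsep : q ∉ connectedComponentIn (Set.range fun z => E (z, 0))ᶜ p)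
    (γ : Path p q) {x : X}
    (hγ : Set.range γ ∩ (Set.range fun z => E (wiggle w ε M k z)) = {x}) :
    m * η ≤ eVariationOn γ Set.univ := by
  obtain ⟨-, z₀, rfl⟩ := hγ.symm.subset rfl
  rcases le_total (wiggle w ε M k z₀).2 0 with h | h
  · exact hE.le_eVariationOn_of_nonpos hM hε hk hkε hη hp hq hsep γ h hγ
  have himg : (E ∘ JordanResistance.flip) '' openCylinder w = E '' openCylinder w := by
    rw [Set.image_comp, Set.image_eq_preimage_of_inverse (g := JordanResistance.flip)
      flip_flip flip_flip]
    congr 1; ext q; simp [openCylinder, JordanResistance.flip]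
  have hrange : ∀ f : Circle → X, (Set.range fun z => f z⁻¹) = Set.range f := fun f =>
    (Equiv.inv Circle).surjective.range_comp f
  refine hE.flip.le_eVariationOn_of_nonpos (z₀ := z₀⁻¹) hM hε hk hkε ?_
    (by rwa [himg]) (by rwa [himg]) ?_ γ ?_ ?_
  · intro q hq q' hq' r hr hr' hrat
    refine hη _ (by simpa [cylinder, JordanResistance.flip] using hq) _
      (by simpa [cylinder, JordanResistance.flip] using hq') (-r) (by rwa [abs_neg])
      (by rwa [abs_neg]) ?_
    simp [JordanResistance.flip, hrat, mul_comm]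
  · have : (fun z => (E ∘ JordanResistance.flip) (z, 0)) = fun z : Circle => E (z⁻¹, 0) := by
      simp [JordanResistance.flip]
    rwa [this, hrange fun z => E (z, 0)]
  · rw [← flip_wiggle]
    simpa [JordanResistance.flip] using h
  · simp only [Function.comp_apply, flip_wiggle, inv_inv]
    rwa [hrange fun z => E (wiggle w ε M k z)]

end Length

end IsCollar

/-! ### The stereographic projection -/

/-- Stereographic projection from the north pole. -/
def stereo (p : S2) : ℂ := ⟨p.1 0 / (1 - p.1 2), p.1 1 / (1 - p.1 2)⟩

lemma norm_sq_eq_re_im (z : ℂ) : ‖z‖ ^ 2 = z.re ^ 2 + z.im ^ 2 := by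
  rw [← Complex.normSq_eq_norm_sq, Complex.normSq_apply]; ring

lemma stereo_stereoInv (z : ℂ) : stereo (stereoInv z) = z := by
  have h : (‖z‖ ^ 2 + 1 : ℝ) ≠ 0 := by positivity
  have h' : 1 - (‖z‖ ^ 2 - 1) / (‖z‖ ^ 2 + 1) = 2 / (‖z‖ ^ 2 + 1) := by field_simp; ring
  apply Complex.ext <;> simp [stereo, stereoInv, h'] <;> field_simp

lemma stereoInv_stereo {p : S2} (hp : p.1 2 ≠ 1) : stereoInv (stereo p) = p := by
  have hs : (p.1 0) ^ 2 + (p.1 1) ^ 2 + (p.1 2) ^ 2 = 1 := by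
    have h := mem_sphere_zero_iff_norm.1 p.2
    rw [← sq_eq_sq₀ (norm_nonneg _) zero_le_one, EuclideanSpace.norm_sq_eq] at h
    simpa [Fin.sum_univ_three] using h
  have h1 : 1 - p.1 2 ≠ 0 := sub_ne_zero.2 hp.symm
  have hn : ‖stereo p‖ ^ 2 = (1 + p.1 2) / (1 - p.1 2) := by
    rw [norm_sq_eq_re_im, stereo]
    field_simp
    linarith
  have hn1 : ‖stereo p‖ ^ 2 + 1 = 2 / (1 - p.1 2) := by rw [hn]; field_simp; ring
  have hn2 : ‖stereo p‖ ^ 2 - 1 = 2 * p.1 2 / (1 - p.1 2) := by rw [hn]; field_simp; ring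
  apply Subtype.ext
  ext i
  simp only [stereoInv, hn1, hn2]
  fin_cases i <;> simp [stereo] <;> field_simp

lemma stereoInv_injective : Function.Injective stereoInv :=
  Function.LeftInverse.injective stereo_stereoInv

lemma stereoInv_apply_two_ne (z : ℂ) : (stereoInv z).1 2 ≠ 1 := by
  have h : (‖z‖ ^ 2 + 1 : ℝ) ≠ 0 := by positivity
  simp only [stereoInv, Matrix.cons_val, ne_eq, div_eq_one_iff_eq h]
  intro h
  linarith

lemma stereoInv_ne_northPole (z : ℂ) : stereoInv z ≠ northPole := by
  intro h
  refine stereoInv_apply_two_ne z ?_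
  rw [h]; simp [northPole]

lemma stereoInv_zero : stereoInv 0 = southPole := by
  apply Subtype.ext
  ext i
  fin_cases i <;> simp [stereoInv, southPole]

lemma continuous_stereoInv : Continuous stereoInv := by
  refine Continuous.subtype_mk ?_ _
  refine (PiLp.continuous_toLp 2 _).comp (continuous_pi fun i => ?_)
  have h : ∀ z : ℂ, (‖z‖ ^ 2 + 1 : ℝ) ≠ 0 := fun z => by positivity
  fin_cases i
  · exact Continuous.div (by fun_prop) (by fun_prop) h
  · exact Continuous.div (by fun_prop) (by fun_prop) h
  · exact Continuous.div (by fun_prop) (by fun_prop) h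

lemma isOpenMap_stereoInv : IsOpenMap stereoInv := by
  intro V hV
  have hcoord : ∀ i : Fin 3, Continuous fun p : S2 => p.1 i := fun i => by fun_prop
  have hO : IsOpen {p : S2 | p.1 2 ≠ 1} := isOpen_ne_fun (hcoord 2) continuous_const
  have hc : ContinuousOn stereo {p : S2 | p.1 2 ≠ 1} := by
    have h1 : ∀ p ∈ {p : S2 | p.1 2 ≠ 1}, 1 - p.1 2 ≠ 0 := fun p hp => sub_ne_zero.2 (Ne.symm hp)
    have h2 : ∀ i : Fin 3, ContinuousOn (fun p : S2 => p.1 i / (1 - p.1 2)) {p : S2 | p.1 2 ≠ 1} :=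
      fun i => (hcoord i).continuousOn.div (continuous_const.sub (hcoord 2)).continuousOn h1
    exact Complex.equivRealProdCLM.symm.continuous.comp_continuousOn ((h2 0).prodMk (h2 1))
  have : stereoInv '' V = {p : S2 | p.1 2 ≠ 1} ∩ stereo ⁻¹' V := by
    ext p
    constructor
    · rintro ⟨z, hz, rfl⟩
      exact ⟨stereoInv_apply_two_ne z, by rwa [Set.mem_preimage, stereo_stereoInv]⟩
    · rintro ⟨hp, hpV⟩
      exact ⟨stereo p, hpV, stereoInv_stereo hp⟩
  rw [this]
  exact hc.isOpen_inter_preimage hO hV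

/-! ### Tubular neighbourhoods of smooth Jordan curves -/

/-- The angular derivative of a map on the circle. -/
def angularDeriv (h : Circle → ℂ) (z : Circle) : ℂ :=
  deriv (fun θ : ℝ => h (Circle.exp θ)) (z : ℂ).arg

/-- The map from the cylinder that translates each point of the curve along its normal. -/
def tubular (h : Circle → ℂ) (q : Circle × ℝ) : ℂ :=
  h q.1 + q.2 * (Complex.I * angularDeriv h q.1)

/-- The tubular map in the angular coordinate. -/
def tubularLift (h : Circle → ℂ) (p : ℝ × ℝ) : ℂ :=
  h (Circle.exp p.1) + p.2 * (Complex.I * deriv (fun θ : ℝ => h (Circle.exp θ)) p.1)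

/-- The derivative of `tubularLift`. -/
def tubularDeriv (h : Circle → ℂ) (p : ℝ × ℝ) : ℝ × ℝ →L[ℝ] ℂ :=
  (ContinuousLinearMap.fst ℝ ℝ ℝ).smulRight (deriv (fun θ : ℝ => h (Circle.exp θ)) p.1 +
    p.2 * (Complex.I * deriv (deriv fun θ : ℝ => h (Circle.exp θ)) p.1)) +
  (ContinuousLinearMap.snd ℝ ℝ ℝ).smulRight
    (Complex.I * deriv (fun θ : ℝ => h (Circle.exp θ)) p.1)

lemma periodic_comp_exp (h : Circle → ℂ) :
    Function.Periodic (fun θ : ℝ => h (Circle.exp θ)) (2 * Real.pi) := fun θ => by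
  simp [Circle.exp_add]

lemma _root_.Function.Periodic.deriv_eq {f : ℝ → ℂ} {c : ℝ} (hf : Function.Periodic f c) :
    Function.Periodic (deriv f) c := fun x => by
  rw [← deriv_comp_add_const, hf.funext]

/-- Periodicity of the derivative makes the choice of angle by `arg` immaterial. -/
lemma angularDeriv_exp (h : Circle → ℂ) (θ : ℝ) :
    angularDeriv h (Circle.exp θ) = deriv (fun θ : ℝ => h (Circle.exp θ)) θ := by
  obtain ⟨m, hm⟩ := Circle.exp_eq_exp.1 (Circle.exp_arg (Circle.exp θ)).symm
  rw [angularDeriv]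
  conv_rhs => rw [hm]
  exact ((periodic_comp_exp h).deriv_eq.int_mul m _).symm

lemma tubular_exp (h : Circle → ℂ) (p : ℝ × ℝ) :
    tubular h (Circle.exp p.1, p.2) = tubularLift h p := by
  simp [tubular, tubularLift, angularDeriv_exp]

lemma tubular_zero (h : Circle → ℂ) (z : Circle) : tubular h (z, 0) = h z := by simp [tubular]

/-! ### Existence of collars and smoothness of the serpentine. -/

namespace IsSmoothJordanParam

variable {h : Circle → ℂ}

lemma contDiff_deriv (hh : IsSmoothJordanParam h) :
    ContDiff ℝ ∞ (deriv fun θ : ℝ => h (Circle.exp θ)) :=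
  (contDiff_infty_iff_deriv.1 hh.smooth).2

lemma continuous_angularDeriv (hh : IsSmoothJordanParam h) : Continuous (angularDeriv h) := by
  have hq : Topology.IsQuotientMap Circle.exp :=
    isLocalHomeomorph_circleExp.isOpenMap.isQuotientMap Circle.exp.continuous
      Circle.exp_surjective
  rw [hq.continuous_iff]
  have : angularDeriv h ∘ Circle.exp = deriv fun θ : ℝ => h (Circle.exp θ) :=
    funext (angularDeriv_exp h)
  rw [this]
  exact hh.contDiff_deriv.continuous

lemma continuous (hh : IsSmoothJordanParam h) : Continuous h := by
  have hq : Topology.IsQuotientMap Circle.exp :=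
    isLocalHomeomorph_circleExp.isOpenMap.isQuotientMap Circle.exp.continuous
      Circle.exp_surjective
  exact hq.continuous_iff.2 hh.smooth.continuous

lemma continuous_tubular (hh : IsSmoothJordanParam h) : Continuous (tubular h) := by
  have h1 := hh.continuous
  have h2 := hh.continuous_angularDeriv
  unfold tubular
  fun_prop

lemma contDiff_tubularLift (hh : IsSmoothJordanParam h) : ContDiff ℝ ∞ (tubularLift h) := by
  have h1 := hh.smooth.comp (contDiff_fst (𝕜 := ℝ) (E := ℝ) (F := ℝ))
  have h2 := hh.contDiff_deriv.comp (contDiff_fst (𝕜 := ℝ) (E := ℝ) (F := ℝ))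
  have h3 := Complex.ofRealCLM.contDiff.comp (contDiff_snd (𝕜 := ℝ) (E := ℝ) (F := ℝ) (n := ∞))
  exact h1.add (h3.mul (contDiff_const.mul h2))

lemma hasStrictFDerivAt_tubularLift (hh : IsSmoothJordanParam h) (p : ℝ × ℝ) :
    HasStrictFDerivAt (tubularLift h) (tubularDeriv h p) p := by
  have h1 : HasStrictDerivAt (fun θ : ℝ => h (Circle.exp θ)) _ p.1 :=
    hh.smooth.contDiffAt.hasStrictDerivAt (by simp)
  have h2 : HasStrictDerivAt (deriv fun θ : ℝ => h (Circle.exp θ)) _ p.1 :=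
    hh.contDiff_deriv.contDiffAt.hasStrictDerivAt (by simp)
  have h1' := h1.hasStrictFDerivAt.comp p hasStrictFDerivAt_fst
  have h2' := h2.hasStrictFDerivAt.comp p hasStrictFDerivAt_fst
  have h3 := Complex.ofRealCLM.hasStrictFDerivAt.comp p (hasStrictFDerivAt_snd (𝕜 := ℝ) (p := p))
  refine (h1'.add (h3.mul (h2'.const_mul Complex.I))).congr_fderiv ?_
  ext <;> simp [tubularDeriv]

/-- After division by `h'`, the real part of the kernel equation is `a * (1 - y * Im (h'' / h')) =
0`. Here `Im (h'' / h')` is curvature times speed, so the condition excludes focal points. -/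
lemma injective_tubularDeriv (hh : IsSmoothJordanParam h) {p : ℝ × ℝ}
    (hp : 1 - p.2 * (deriv (deriv fun θ : ℝ => h (Circle.exp θ)) p.1 /
      deriv (fun θ : ℝ => h (Circle.exp θ)) p.1).im ≠ 0) :
    Function.Injective (tubularDeriv h p) := by
  rw [injective_iff_map_eq_zero]
  rintro ⟨a, b⟩ hab
  have h0 := hh.deriv_ne_zero p.1
  set d := deriv (fun θ : ℝ => h (Circle.exp θ)) p.1
  set e := deriv (deriv fun θ : ℝ => h (Circle.exp θ)) p.1
  have h1 : (a : ℂ) * (1 + p.2 * (Complex.I * (e / d))) + b * Complex.I = 0 := by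
    have h2 : (a : ℂ) * (d + p.2 * (Complex.I * e)) + b * (Complex.I * d) = 0 := by
      simpa [tubularDeriv, mul_add] using hab
    have h3 : ((a : ℂ) * (1 + p.2 * (Complex.I * (e / d))) + b * Complex.I) * d = 0 := by
      rw [← h2]; field_simp
    exact (mul_eq_zero.1 h3).resolve_right h0
  have hre := congrArg Complex.re h1
  have ha : a = 0 := by
    have : a * (1 - p.2 * (e / d).im) = 0 := by
      simpa [sub_eq_add_neg] using hre
    exact (mul_eq_zero.1 this).resolve_right hp
  have hb : b = 0 := by
    rw [ha] at h1
    simpa using h1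
  rw [ha, hb]; rfl

/-- The tubular map is an immersion near the zero section. -/
lemma exists_injective_tubularDeriv (hh : IsSmoothJordanParam h) :
    ∃ w > 0, ∀ p : ℝ × ℝ, |p.2| < w → Function.Injective (tubularDeriv h p) := by
  set κ : ℝ → ℝ := fun θ => (deriv (deriv fun θ : ℝ => h (Circle.exp θ)) θ /
      deriv (fun θ : ℝ => h (Circle.exp θ)) θ).im with hκ
  have hc : Continuous κ := by
    have h1 := hh.contDiff_deriv
    exact Complex.continuous_im.comp
      ((contDiff_infty_iff_deriv.1 h1).2.continuous.div h1.continuous hh.deriv_ne_zero)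
  have hper : Function.Periodic κ (2 * Real.pi) := fun θ => by
    have h1 := (periodic_comp_exp h).deriv_eq
    simp only [hκ, h1 θ, h1.deriv_eq θ]
  obtain ⟨C, hC⟩ := (hper.isBounded_of_continuous Real.two_pi_pos.ne' hc).exists_norm_le
  have hC' : ∀ θ, |κ θ| ≤ C := fun θ => hC _ ⟨θ, rfl⟩
  have hC0 : 0 ≤ C := (abs_nonneg _).trans (hC' 0)
  refine ⟨1 / (C + 1), by positivity, fun p hp => hh.injective_tubularDeriv ?_⟩
  have h1 : |p.2 * κ p.1| < 1 := by
    rw [abs_mul]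
    rw [lt_div_iff₀ (by positivity)] at hp
    nlinarith [hC' p.1, abs_nonneg p.2, abs_nonneg (κ p.1)]
  exact (sub_pos.2 (abs_lt.1 h1).2).ne'

/-- An injective derivative of the tubular map is invertible. -/
lemma hasStrictFDerivAt_equiv (hh : IsSmoothJordanParam h) {p : ℝ × ℝ}
    (hp : Function.Injective (tubularDeriv h p)) :
    ∃ e : (ℝ × ℝ) ≃L[ℝ] ℂ, HasStrictFDerivAt (tubularLift h) (e : ℝ × ℝ →L[ℝ] ℂ) p := by
  let e := (LinearEquiv.ofInjectiveOfFinrankEq (tubularDeriv h p : ℝ × ℝ →ₗ[ℝ] ℂ) hp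
    (by simp)).toContinuousLinearEquiv
  refine ⟨e, (hh.hasStrictFDerivAt_tubularLift p).congr_fderiv ?_⟩
  ext <;> rfl

/-- The tubular map is injective near the zero section. -/
lemma exists_injOn_tubular (hh : IsSmoothJordanParam h) :
    ∃ t ∈ nhdsSet (Set.univ ×ˢ {(0 : ℝ)}), Set.InjOn (tubular h) t := by
  -- On the compact zero section, injectivity and local injectivity nearby together give injectivity
  -- on a neighbourhood.
  refine Set.InjOn.exists_mem_nhdsSet ?_ (isCompact_univ.prod isCompact_singleton)
    (fun x _ => hh.continuous_tubular.continuousAt) ?_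
  · rintro ⟨z, y⟩ ⟨-, rfl⟩ ⟨z', y'⟩ ⟨-, rfl⟩ hzz
    rw [tubular_zero, tubular_zero] at hzz
    rw [hh.injective hzz]
  · rintro ⟨z, y⟩ ⟨-, rfl⟩
    obtain ⟨θ, rfl⟩ := Circle.exp_surjective z
    obtain ⟨w, hw, hinj⟩ := hh.exists_injective_tubularDeriv
    obtain ⟨e, he⟩ := hh.hasStrictFDerivAt_equiv (hinj (θ, 0) (by simpa using hw))
    set φ := he.toOpenPartialHomeomorph (tubularLift h) with hφ
    have hopen : IsOpenMap (Prod.map Circle.exp (id : ℝ → ℝ)) :=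
      isLocalHomeomorph_circleExp.isOpenMap.prodMap IsOpenMap.id
    refine ⟨Prod.map Circle.exp id '' φ.source,
      hopen.image_mem_nhds (φ.open_source.mem_nhds he.mem_toOpenPartialHomeomorph_source), ?_⟩
    rintro _ ⟨p, hp, rfl⟩ _ ⟨p', hp', rfl⟩ hpp
    have : tubularLift h p = tubularLift h p' := by
      rw [← tubular_exp, ← tubular_exp]; exact hpp
    rw [φ.injOn hp hp' this]

lemma isOpen_image_tubular (hh : IsSmoothJordanParam h) {w : ℝ}
    (hw : ∀ p : ℝ × ℝ, |p.2| < w → Function.Injective (tubularDeriv h p)) :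
    IsOpen (tubular h '' openCylinder w) := by
  rw [isOpen_iff_mem_nhds]
  rintro _ ⟨⟨z, y⟩, hy, rfl⟩
  obtain ⟨θ, rfl⟩ := Circle.exp_surjective z
  obtain ⟨e, he⟩ := hh.hasStrictFDerivAt_equiv (hw (θ, y) hy)
  rw [tubular_exp h (θ, y), ← he.map_nhds_eq_of_equiv, Filter.mem_map]
  have hO : IsOpen {p : ℝ × ℝ | |p.2| < w} := isOpen_lt (by fun_prop) continuous_const
  filter_upwards [hO.mem_nhds hy] with p hp
  exact ⟨(Circle.exp p.1, p.2), hp, tubular_exp h p⟩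

/-- A smooth Jordan curve missing `0` has a collar missing `0`. -/
lemma exists_collar (hh : IsSmoothJordanParam h) (h0 : 0 ∉ Set.range h) :
    ∃ w₀ > 0, ∀ w, 0 < w → w < w₀ → IsCollar (tubular h) w ∧ 0 ∉ tubular h '' cylinder w ∧
      ∀ p : ℝ × ℝ, |p.2| < w → Function.Injective (tubularDeriv h p) := by
  obtain ⟨t, ht, hinj⟩ := hh.exists_injOn_tubular
  obtain ⟨w₁, hw₁, hder⟩ := hh.exists_injective_tubularDeriv
  have hO : IsOpen (interior t ∩ {q | tubular h q ≠ 0}) :=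
    isOpen_interior.inter (isOpen_ne_fun hh.continuous_tubular continuous_const)
  have hsub : Set.univ ×ˢ {(0 : ℝ)} ⊆ interior t ∩ {q | tubular h q ≠ 0} := by
    rintro ⟨z, y⟩ ⟨hz, rfl⟩
    refine ⟨subset_interior_iff_mem_nhdsSet.2 ht ⟨hz, rfl⟩, fun hzero => h0 ⟨z, ?_⟩⟩
    rwa [tubular_zero] at hzero
  obtain ⟨u, v, -, hv, hu, hv0, huv⟩ :=
    generalized_tube_lemma isCompact_univ isCompact_singleton hO hsub
  obtain ⟨w₂, hw₂, hball⟩ := Metric.isOpen_iff.1 hv 0 (hv0 rfl)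
  refine ⟨min w₁ w₂, lt_min hw₁ hw₂, fun w hw hww => ?_⟩
  have hcyl : ∀ q ∈ cylinder w, q ∈ interior t ∩ {q | tubular h q ≠ 0} := fun q hq =>
    huv ⟨hu trivial, hball (by
      rw [Metric.mem_ball, Real.dist_0_eq_abs]
      exact (show |q.2| ≤ w from hq).trans_lt (hww.trans_le (min_le_right _ _)))⟩
  have hder' : ∀ p : ℝ × ℝ, |p.2| < w → Function.Injective (tubularDeriv h p) := fun p hp =>
    hder p (hp.trans (hww.trans_le (min_le_left _ _)))
  exact ⟨⟨hw, hh.continuous_tubular, hinj.mono fun q hq => interior_subset (hcyl q hq).1,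
    hh.isOpen_image_tubular hder'⟩, fun ⟨q, hq, hq0⟩ => (hcyl q hq).2 hq0, hder'⟩

/-- The serpentine curve in a collar of a smooth Jordan curve is a smooth Jordan curve. -/
lemma tubular_wiggle (hh : IsSmoothJordanParam h) {w ε M : ℝ} {k : ℕ}
    (hcol : IsCollar (tubular h) w)
    (hder : ∀ p : ℝ × ℝ, |p.2| < w → Function.Injective (tubularDeriv h p)) :
    IsSmoothJordanParam fun z => tubular h (wiggle w ε M k z) := by
  let b : ℝ → ℝ := fun θ => w / 2 * Real.sin (k * θ)
  let a : ℝ → ℝ := fun θ => θ + ε * Real.sin (M * b θ)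
  have him : ∀ θ : ℝ, ((Circle.exp θ : ℂ) ^ k).im = Real.sin (k * θ) := fun θ => by
    rw [← Circle.coe_pow, ← Circle.exp_natCast_mul, Circle.coe_exp, Complex.exp_ofReal_mul_I_im]
  have hwig : ∀ θ, wiggle w ε M k (Circle.exp θ) = (Circle.exp (a θ), b θ) := fun θ => by
    rw [wiggle, him, ← Circle.exp_add]
  have heq : (fun θ : ℝ => tubular h (wiggle w ε M k (Circle.exp θ))) =
      tubularLift h ∘ fun θ => (a θ, b θ) := by
    funext θ
    rw [hwig, Function.comp_apply, ← tubular_exp]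
  have hb : ContDiff ℝ ∞ b := by fun_prop
  have ha : ContDiff ℝ ∞ a := by fun_prop
  refine ⟨fun z z' hzz => ?_, ?_, fun θ => ?_⟩
  · exact wiggle_injective (hcol.injOn
      (openCylinder_subset w (IsCollar.wiggle_mem_openCylinder hcol.pos z))
      (openCylinder_subset w (IsCollar.wiggle_mem_openCylinder hcol.pos z')) hzz)
  · rw [heq]
    exact hh.contDiff_tubularLift.comp (ha.prodMk hb)
  · rw [heq]
    have hb' : HasDerivAt b (deriv b θ) θ := (hb.differentiable (by simp) θ).hasDerivAt
    have ha' : HasDerivAt a (1 + ε * (Real.cos (M * b θ) * (M * deriv b θ))) θ :=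
      (hasDerivAt_id θ).add (((hb'.const_mul M).sin).const_mul ε)
    rw [((hh.hasStrictFDerivAt_tubularLift (a θ, b θ)).hasFDerivAt.comp_hasDerivAt θ
      (ha'.prodMk hb')).deriv]
    intro hzero
    have hbθ : |b θ| < w := by
      have := IsCollar.wiggle_mem_openCylinder (ε := ε) (M := M) (k := k) hcol.pos (Circle.exp θ)
      rwa [hwig] at this
    -- The velocity `(a', b')` would vanish, but `b' = 0` forces `a' = 1`.
    have h1 := (injective_iff_map_eq_zero _).1 (hder (a θ, b θ) hbθ) _ hzero
    have h2 : deriv b θ = 0 := (Prod.ext_iff.1 h1).2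
    have h3 := (Prod.ext_iff.1 h1).1
    simp [h2] at h3

/-- The tubular map moves points little near the zero section. -/
lemma exists_tubular_near (hh : IsSmoothJordanParam h) {δ : ℝ} (hδ : 0 < δ) :
    ∃ r > 0, ∀ (z : Circle) (s y : ℝ), |s| < r → |y| < r →
      ‖h z - tubular h (z * Circle.exp s, y)‖ < δ := by
  have hc := hh.continuous_tubular
  have hc' := hh.continuous
  have hO : IsOpen {p : Circle × ℝ × ℝ |
      ‖h p.1 - tubular h (p.1 * Circle.exp p.2.1, p.2.2)‖ < δ} :=
    isOpen_lt (by fun_prop) continuous_const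
  obtain ⟨u, v, -, hv, hu, hv0, huv⟩ := generalized_tube_lemma (isCompact_univ (X := Circle))
    (isCompact_singleton (x := ((0 : ℝ), (0 : ℝ)))) hO (by
      rintro ⟨z, p⟩ ⟨-, rfl⟩
      simpa [tubular_zero] using hδ)
  obtain ⟨r, hr, hball⟩ := Metric.isOpen_iff.1 hv (0, 0) (hv0 rfl)
  refine ⟨r, hr, fun z s y hs hy => ?_⟩
  have hm : (z, s, y) ∈ u ×ˢ v := ⟨hu trivial, hball (by
    rw [Metric.mem_ball, Prod.dist_eq, Real.dist_0_eq_abs, Real.dist_0_eq_abs]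
    exact max_lt hs hy)⟩
  exact huv hm

end IsSmoothJordanParam

/-- Stereographic projection transports collars to the sphere. -/
lemma IsCollar.stereoInv_comp {E : Circle × ℝ → ℂ} {w : ℝ} (hE : IsCollar E w) :
    IsCollar (stereoInv ∘ E) w where
  pos := hE.pos
  continuous := continuous_stereoInv.comp hE.continuous
  injOn := stereoInv_injective.comp_injOn hE.injOn
  isOpen := by
    rw [Set.image_comp]
    exact isOpenMap_stereoInv _ hE.isOpen

lemma curveOnSphere_eq (h : Circle → ℂ) : curveOnSphere h = Set.range fun z => stereoInv (h z) :=
  (Set.range_comp stereoInv h).symm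

end JordanResistance

end

/-! ### Choice of the parameters. -/

open JordanResistance in
theorem theorem5p2 (h : C(Circle, ℂ)) (hh : JordanResistance.IsSmoothJordanParam h)
    (hsep : JordanResistance.Separates (JordanResistance.curveOnSphere h)
      JordanResistance.northPole JordanResistance.southPole)
    (δ L : ℝ) (hδ : 0 < δ) (hL : 0 < L) :
    ∃ h₁ : C(Circle, ℂ), JordanResistance.IsSmoothJordanParam h₁ ∧
      JordanResistance.Separates (JordanResistance.curveOnSphere h₁)
        JordanResistance.northPole JordanResistance.southPole ∧
      ‖h - h₁‖ < δ ∧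
      ENNReal.ofReal L < JordanResistance.resistance (JordanResistance.curveOnSphere h₁) := by
  obtain ⟨-, hS, hsep⟩ := hsep
  have h0 : 0 ∉ Set.range h := by
    rintro ⟨z, hz⟩
    exact hS ⟨0, ⟨z, hz⟩, stereoInv_zero⟩
  obtain ⟨w₀, hw₀, hcol⟩ := hh.exists_collar h0
  obtain ⟨r, hr, hnear⟩ := hh.exists_tubular_near hδ
  obtain ⟨w, hw, hww⟩ := exists_between (lt_min hw₀ hr)
  -- `ε < r` serves closeness to `h`, and `ε < 1` the distance bound `exists_le_edist`.
  obtain ⟨ε, hε, hεr⟩ := exists_between (lt_min hr one_pos)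
  obtain ⟨hE, hE0, hder⟩ := hcol w hw (hww.trans_le (min_le_left _ _))
  have hF := hE.stereoInv_comp
  have hN : northPole ∉ (stereoInv ∘ tubular h) '' cylinder w := by
    rintro ⟨q, -, hq⟩
    exact stereoInv_ne_northPole _ hq
  have hS' : southPole ∉ (stereoInv ∘ tubular h) '' cylinder w := by
    rintro ⟨q, hq, hqS⟩
    exact hE0 ⟨q, hq, stereoInv_injective (hqS.trans stereoInv_zero.symm)⟩
  have hsub := Set.image_mono (f := stereoInv ∘ tubular h) (openCylinder_subset w)
  have hbase : (Set.range fun z => (stereoInv ∘ tubular h) (z, 0)) = curveOnSphere h := by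
    simp only [curveOnSphere_eq, Function.comp_apply, tubular_zero]
  rw [← hbase] at hsep
  obtain ⟨η, hη, hηE⟩ := hF.exists_le_edist hε (hεr.le.trans (min_le_right _ _))
  -- `η` involves neither `M` nor `k`, so both may still be chosen freely.
  obtain ⟨m, hm⟩ := exists_nat_gt (L / η)
  obtain ⟨k, hk⟩ := exists_nat_gt (2 * Real.pi / ε)
  have hk0 : (0 : ℝ) < k := lt_trans (by positivity) hk
  have hkε : 2 * Real.pi / k ≤ ε := by
    rw [div_lt_iff₀ hε] at hk
    rw [div_le_iff₀ hk0]
    linarith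
  set M : ℝ := (4 * (m + 1)) * Real.pi / w with hM
  have hMw : Real.sin (M * w) = 0 := by
    have : M * w = (4 * (m + 1) : ℕ) * Real.pi := by
      rw [hM]; push_cast; field_simp
    rw [this, Real.sin_nat_mul_pi]
  have hsmooth := hh.tubular_wiggle (ε := ε) (M := M) (k := k) hE hder
  let h₁ : C(Circle, ℂ) := ⟨fun z => tubular h (wiggle w ε M k z), hsmooth.continuous⟩
  have hcurve : curveOnSphere h₁ =
      Set.range fun z => (stereoInv ∘ tubular h) (wiggle w ε M k z) := curveOnSphere_eq _
  have hK : curveOnSphere h₁ ⊆ (stereoInv ∘ tubular h) '' cylinder w := by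
    rw [hcurve]
    rintro _ ⟨z, rfl⟩
    exact hsub ⟨_, IsCollar.wiggle_mem_openCylinder hw z, rfl⟩
  have hsep₁ : Separates (curveOnSphere h₁) northPole southPole := by
    refine ⟨fun h => hN (hK h), fun h => hS' (hK h), ?_⟩
    have hN₁ : northPole ∈ (curveOnSphere h₁)ᶜ := fun h => hN (hK h)
    refine hF.notMem_of_isPreconnected (ε := ε) (k := k) hMw (fun h => hN (hsub h))
      (fun h => hS' (hsub h)) hsep isPreconnected_connectedComponentIn
      (mem_connectedComponentIn hN₁) ?_
    rw [← hcurve]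
    exact Set.disjoint_left.2 fun x hx => connectedComponentIn_subset _ _ hx
  refine ⟨h₁, hsmooth, hsep₁, ?_, ?_⟩
  · rw [ContinuousMap.norm_lt_iff _ hδ]
    intro z
    refine hnear z _ _ ?_ ?_
    · rw [abs_mul, abs_of_pos hε]
      have := Real.abs_sin_le_one (M * (w / 2 * ((z : ℂ) ^ k).im))
      have h2 := hεr.trans_le (min_le_left _ _)
      nlinarith
    · exact (IsCollar.wiggle_mem_openCylinder (ε := ε) (M := M) (k := k) hw z).trans
        (hww.trans_le (min_le_right _ _))
  · have hlt : ENNReal.ofReal L < m * ENNReal.ofReal η := by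
      rw [← ENNReal.ofReal_natCast, ← ENNReal.ofReal_mul (Nat.cast_nonneg m)]
      rw [div_lt_iff₀ hη] at hm
      exact (ENNReal.ofReal_lt_ofReal_iff (hL.trans hm)).2 hm
    refine hlt.trans_le (le_iInf₂ fun γ hγ => ?_)
    obtain ⟨⟨x, hx⟩, -⟩ := hγ
    rw [hcurve] at hx
    exact hF.le_eVariationOn_path hM hε (by exact_mod_cast hk0) hkε hηE (fun h => hN (hsub h))
      (fun h => hS' (hsub h)) hsep γ hx
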